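/- Let $n \ge 0$ and let $C\ell_{0,n}$ be the real Clifford algebra generated by $i_1,\dots,i_n$ with $i_j^2=-1$ and $i_ji_k=-i_ki_j$ for $j\ne k$. For $I=\{j_1<\dots<j_k\}\subseteq\{1,\dots,n\}$ put $i_I=i_{j_1}\cdots i_{j_k}$, a monomial of degree $k$; let $\mathbb{R}^{0,n}$ be the span of $i_1,\dots,i_n$ (the vectors) and let $\bigwedge^2\mathbb{R}^{0,n}\subseteq C\ell_{0,n}$ be the span of the monomials of degree $2$. Let $\$\Gamma_{n+1}$ be the paravector Lipschitz group, that is, the subgroup of the group of invertible elements of $C\ell_{0,n}$ generated by the invertible paravectors, i.e. the invertible elements of $\mathbb{R}\oplus\mathbb{R}^{0,n}$. Then $\$\Gamma_{n+1}$, with the topology induced from $C\ell_{0,n}$, is a Lie group smoothly embedded in the vector space $C\ell_{0,n}$. For every such embedded Lie group structure, the derivative at the identity of the inclusion $\$\Gamma_{n+1}\hookrightarrow C\ell_{0,n}$ is injective and identifies the Lie algebra $\$\mathfrak{g}_{n+1}$ of $\$\Gamma_{n+1}$ with the space of elements of $C\ell_{0,n}$ all of whose terms have degree $\le 2$, that is,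 \[ \$\mathfrak{g}_{n+1} = \mathbb{R}\oplus\mathbb{R}^{0,n}\oplus{\bigwedge}^{2}\mathbb{R}^{0,n} \] (an internal direct sum), and under this identification the Lie bracket is the commutator $[X,Y]=XY-YX$. -/

import Mathlib

open scoped Manifold ContDiff

noncomputable section

/-- The quadratic form `-(x₁² + ⋯ + xₙ²)` on `ℝⁿ`, i.e. the quadratic space `ℝ^{0,n}`. -/
abbrev negDefForm (n : ℕ) : QuadraticForm ℝ (Fin n → ℝ) :=
  QuadraticMap.weightedSumSquares ℝ (fun _ : Fin n => (-1 : ℝ))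

/-- The Clifford algebra `Cl_{0,n}`, generated by `i₁, …, iₙ` with `i_j² = -1` and
`i_j i_k = - i_k i_j` for `j ≠ k`. -/
abbrev Cl (n : ℕ) : Type := CliffordAlgebra (negDefForm n)

namespace Cl

/-- The generator `i_j` of `Cl_{0,n}`. -/
def gen {n : ℕ} (j : Fin n) : Cl n := CliffordAlgebra.ι (negDefForm n) (Pi.single j 1)

theorem gen_mul_self {n : ℕ} (j : Fin n) : gen j * gen j = (-1 : Cl n) := by
  rw [gen, CliffordAlgebra.ι_sq_scalar, QuadraticMap.weightedSumSquares_apply,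
    Finset.sum_eq_single j]
  · simp
  · intro b _ hb
    simp [hb]
  · simp

theorem gen_mul_gen {n : ℕ} {j k : Fin n} (h : j ≠ k) :
    gen j * gen k = (-(gen k * gen j) : Cl n) := by
  rw [eq_neg_iff_add_eq_zero, gen, gen, CliffordAlgebra.ι_mul_ι_add_swap]
  have : QuadraticMap.polar (negDefForm n) (Pi.single j 1) (Pi.single k 1) = 0 := by
    simp only [QuadraticMap.polar, QuadraticMap.weightedSumSquares_apply, ← Finset.sum_sub_distrib]
    refine Finset.sum_eq_zero fun i _ => ?_
    by_cases hj : i = j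
    · subst hj; simp [h]
    · simp [hj]
  rw [this, map_zero]

/-- The reduced monomial `i_I = i_{j₁} ⋯ i_{j_k}` for `I = {j₁ < ⋯ < j_k}`. -/
def monomial {n : ℕ} (I : Finset (Fin n)) : Cl n := ((I.sort (· ≤ ·)).map gen).prod

/-- The elements of `Cl_{0,n}` all of whose terms have degree at most `k`. -/
def degreeLE (n k : ℕ) : Submodule ℝ (Cl n) :=
  Submodule.span ℝ {x | ∃ I : Finset (Fin n), I.card ≤ k ∧ x = monomial I}

/-- The scalars `ℝ ⊆ Cl_{0,n}`. -/
def scalars (n : ℕ) : Submodule ℝ (Cl n) := LinearMap.range (Algebra.linearMap ℝ (Cl n))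

/-- The vectors `ℝ^{0,n} ⊆ Cl_{0,n}`. -/
def vectors (n : ℕ) : Submodule ℝ (Cl n) := LinearMap.range (CliffordAlgebra.ι (negDefForm n))

/-- The space `⋀² ℝ^{0,n} ⊆ Cl_{0,n}` of elements of degree two. -/
def bivectors (n : ℕ) : Submodule ℝ (Cl n) :=
  Submodule.span ℝ {x | ∃ I : Finset (Fin n), I.card = 2 ∧ x = monomial I}

/-- The paravectors `ℝ ⊕ ℝ^{0,n}`. -/
def paravectors (n : ℕ) : Submodule ℝ (Cl n) := scalars n ⊔ vectors n

/-- The paravector Lipschitz group: the subgroup of the group of invertible elements of `Cl_{0,n}`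
that is generated by the invertible paravectors. -/
def lipschitzGroup (n : ℕ) : Subgroup (Cl n)ˣ :=
  Subgroup.closure {u | (u : Cl n) ∈ paravectors n}

instance finite (n : ℕ) : Module.Finite ℝ (Cl n) := by
  have : Module.Finite ℝ (ExteriorAlgebra ℝ (Fin n → ℝ)) := by
    rw [Module.finite_def]
    have htop : (⊤ : Submodule ℝ (ExteriorAlgebra ℝ (Fin n → ℝ))) =
        ⨆ i ∈ Finset.range (n + 1), ⋀[ℝ]^i (Fin n → ℝ) := by
      rw [← (DirectSum.Decomposition.isInternal
        (fun i : ℕ => ⋀[ℝ]^i (Fin n → ℝ))).submodule_iSup_eq_top]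
      refine le_antisymm (iSup_le fun i => ?_) (iSup₂_le fun i _ => le_iSup _ i)
      by_cases hi : i ∈ Finset.range (n + 1)
      · exact le_iSup₂_of_le i hi le_rfl
      · have : ⋀[ℝ]^i (Fin n → ℝ) = ⊥ := by
          rw [← Submodule.finrank_eq_zero (R := ℝ), exteriorPower.finrank_eq]
          simp only [Module.finrank_fin_fun]
          exact Nat.choose_eq_zero_of_lt (by simpa using hi)
        rw [this]
        exact bot_le
    rw [htop]
    exact Submodule.fg_biSup _ _ fun i _ => Module.Finite.iff_fg.1 inferInstance
  exact Module.Finite.equiv (CliffordAlgebra.equivExterior (negDefForm n)).symm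

/-- The embedding of `Cl_{0,n}` in a matrix algebra given by its left regular representation. -/
def toMatrix (n : ℕ) : Cl n →ₐ[ℝ]
    Matrix (Fin (Module.finrank ℝ (Cl n))) (Fin (Module.finrank ℝ (Cl n))) ℝ :=
  Algebra.leftMulMatrix (Module.finBasis ℝ (Cl n))

theorem toMatrix_injective (n : ℕ) : Function.Injective (toMatrix n) :=
  Algebra.leftMulMatrix_injective _

/-- A submultiplicative norm on the finite-dimensional algebra `Cl_{0,n}`. It only serves to equip
`Cl_{0,n}` with its canonical topology and smooth structure as a finite-dimensional real vector
space, for which all norms are equivalent. -/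
instance normedRing (n : ℕ) : NormedRing (Cl n) :=
  letI := Matrix.linftyOpNormedRing (n := Fin (Module.finrank ℝ (Cl n))) (α := ℝ)
  NormedRing.induced (Cl n) _ (toMatrix n) (toMatrix_injective n)

instance normedAlgebra (n : ℕ) : NormedAlgebra ℝ (Cl n) :=
  letI := Matrix.linftyOpNormedRing (n := Fin (Module.finrank ℝ (Cl n))) (α := ℝ)
  letI := Matrix.linftyOpNormedAlgebra (n := Fin (Module.finrank ℝ (Cl n))) (R := ℝ) (α := ℝ)
  NormedAlgebra.induced ℝ (Cl n) _ (toMatrix n)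

/-- The inclusion of the paravector Lipschitz group in `Cl_{0,n}`. -/
def incl (n : ℕ) (g : lipschitzGroup n) : Cl n := ((g : (Cl n)ˣ) : Cl n)

/-- A smooth atlas on the paravector Lipschitz group (with the topology induced from `Cl_{0,n}`)
makes it an embedded Lie group if it is a Lie group and its inclusion in the vector space
`Cl_{0,n}` is a smooth embedding. -/
structure IsEmbeddedLieGroup (n d : ℕ)
    [ChartedSpace (EuclideanSpace ℝ (Fin d)) (lipschitzGroup n)] : Prop where
  lieGroup : LieGroup (𝓡 d) ∞ (lipschitzGroup n)
  isSmoothEmbedding : Manifold.IsSmoothEmbedding (𝓡 d) 𝓘(ℝ, Cl n) ∞ (incl n)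

/-- The derivative at the identity of the inclusion of the paravector Lipschitz group in
`Cl_{0,n}`, by which its Lie algebra (the tangent space at the identity, with the Lie bracket of
left-invariant vector fields) is regarded as a space of elements of `Cl_{0,n}`. -/
def lieIncl (n d : ℕ) [ChartedSpace (EuclideanSpace ℝ (Fin d)) (lipschitzGroup n)] :
    GroupLieAlgebra (𝓡 d) (lipschitzGroup n) →L[ℝ] Cl n :=
  mfderiv (𝓡 d) 𝓘(ℝ, Cl n) (incl n) 1

end Cl

end

/-! Write `û` for the grade involution of `u`. For an invertible paravector `u` the product `u û` is
a nonzero scalar, so `x ↦ u x û⁻¹` is a multiple of `x ↦ u x u` and preserves the paravectors; hence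
so does every element of the group. Infinitesimally, `X x - x X̂` is a paravector for every
paravector `x`. Taking `x = i_j` compares `X` with its image under `i_j ↦ -i_j` and kills all terms
of degree above two (`mem_degreeLE_two_of_commutator`). Conversely, `1 + t i_I` lies in the group
for `|I| ≤ 2` and small `t`, which supplies all the velocities needed.

For the Lie group structure, the same two facts are carried to the exponential map: near `0`, `exp
X` lies in the group exactly when `X` has degree at most two
(`eventually_exp_mem_lipschitzGroup_iff`). Translated logarithms are then charts in which the
inclusion is linear (`Subgroup.ExpParam`).

For an arbitrary embedded structure, the immersion property makes the derivative injective,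
velocities of curves determine its range (`range_lieIncl`), and the bracket is computed from the
fact that left-invariant fields become `g ↦ g X` in the algebra (`groupLieAlgebraMap_bracket`). -/

noncomputable section

open Filter Topology

/-! ### The monomial basis and the twisted commutator. -/

namespace Cl
variable {n : ℕ}

theorem ι_eq_sum_gen (v : Fin n → ℝ) :
    CliffordAlgebra.ι (negDefForm n) v = ∑ j, v j • gen j := by
  conv_lhs => rw [pi_eq_sum_univ' v]
  rw [map_sum]
  refine Finset.sum_congr rfl fun j _ => ?_
  rw [map_smul, gen]

theorem gen_mem_vectors (j : Fin n) : gen j ∈ vectors n := LinearMap.mem_range_self _ _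

theorem vectors_eq_span : vectors n = Submodule.span ℝ (Set.range gen) := by
  refine le_antisymm ?_ (Submodule.span_le.2 ?_)
  · rintro _ ⟨v, rfl⟩
    rw [ι_eq_sum_gen]
    exact Submodule.sum_mem _ fun j _ =>
      Submodule.smul_mem _ _ (Submodule.subset_span ⟨j, rfl⟩)
  · rintro _ ⟨j, rfl⟩
    exact gen_mem_vectors j

/-- The automorphism of `Cl_{0,n}` that changes the sign of the generator `i_j`. -/
def flip (j : Fin n) : Cl n →ₐ[ℝ] Cl n :=
  CliffordAlgebra.map
    { toLinearMap := LinearMap.pi fun i => (if i = j then (-1 : ℝ) else 1) • LinearMap.proj i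
      map_app' := fun v => by
        simp only [QuadraticMap.weightedSumSquares_apply]
        refine Finset.sum_congr rfl fun i _ => ?_
        by_cases h : i = j <;> simp [h] }

theorem flip_gen (j k : Fin n) : flip j (gen k) = (if k = j then (-1 : ℝ) else 1) • gen k := by
  rw [flip, gen, CliffordAlgebra.map_apply_ι, ← map_smul]
  congr 1
  ext i
  change (if i = j then (-1 : ℝ) else 1) • (Pi.single k 1 : Fin n → ℝ) i = _
  by_cases h : i = k
  · subst h; simp
  · simp [h]

theorem flip_prod_gen (j : Fin n) (l : List (Fin n)) :
    flip j (l.map gen).prod =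
      (l.map fun k => if k = j then (-1 : ℝ) else 1).prod • (l.map gen).prod := by
  induction l with
  | nil => simp
  | cons a l ih =>
    simp only [List.map_cons, List.prod_cons, map_mul, ih, flip_gen, smul_mul_smul_comm]

theorem flip_monomial (j : Fin n) (I : Finset (Fin n)) :
    flip j (monomial I) = (if j ∈ I then (-1 : ℝ) else 1) • monomial I := by
  rw [monomial, flip_prod_gen]
  congr 1
  rw [← Multiset.prod_coe, ← Multiset.map_coe, Finset.sort_eq]
  exact Finset.prod_ite_eq' I j fun _ => (-1 : ℝ)

/-- Moving `i_j` past `i_k` costs a sign for `k ≠ j` only, and the involution changes every sign, so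
just the sign at `k = j` survives. -/
theorem gen_mul_involute (j : Fin n) (X : Cl n) :
    gen j * CliffordAlgebra.involute X = flip j X * gen j := by
  induction X using CliffordAlgebra.induction with
  | algebraMap r => rw [AlgHom.commutes, AlgHom.commutes, Algebra.commutes]
  | ι v =>
    simp only [ι_eq_sum_gen, map_sum, map_smul, Finset.mul_sum, Finset.sum_mul]
    refine Finset.sum_congr rfl fun k _ => ?_
    rw [flip_gen, gen, gen, CliffordAlgebra.involute_ι, ← gen, ← gen]
    by_cases h : k = j
    · subst h; simp
    · rw [smul_mul_assoc, if_neg h, one_smul, gen_mul_gen h, mul_smul_comm, mul_neg]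
  | mul a b ha hb => rw [map_mul, map_mul, ← mul_assoc, ha, mul_assoc, hb, mul_assoc]
  | add a b ha hb => rw [map_add, map_add, mul_add, add_mul, ha, hb]

theorem monomial_toFinset {l : List (Fin n)} (hl : l.Pairwise (· < ·)) :
    monomial l.toFinset = (l.map gen).prod := by
  rw [monomial, (List.toFinset_sort (· ≤ ·) hl.nodup).2 (hl.imp le_of_lt)]

theorem monomial_empty : monomial (∅ : Finset (Fin n)) = 1 := by simp [monomial]

theorem monomial_singleton (j : Fin n) : monomial {j} = gen j := by simp [monomial]

theorem monomial_pair {j k : Fin n} (h : j < k) : monomial {j, k} = gen j * gen k := by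
  have := monomial_toFinset (l := [j, k]) (by simpa using h)
  simpa using this

/-- Insertion sort with signs. The bound on the members of `l'` is what keeps the list increasing
when a smaller head is put back in the induction. -/
theorem gen_mul_prod_gen (j : Fin n) (l : List (Fin n)) (hl : l.Pairwise (· < ·)) :
    ∃ l' : List (Fin n), l'.Pairwise (· < ·) ∧ (∀ x ∈ l', x = j ∨ x ∈ l) ∧
      ∃ s : ℝ, gen j * (l.map gen).prod = s • (l'.map gen).prod := by
  induction l with
  | nil => exact ⟨[j], by simp, by simp, 1, by simp⟩
  | cons a l ih =>
    obtain ⟨hal, hl'⟩ := List.pairwise_cons.1 hl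
    rcases lt_trichotomy j a with h | h | h
    · refine ⟨j :: a :: l, ?_, by simp, 1, by simp⟩
      refine List.pairwise_cons.2 ⟨?_, hl⟩
      rintro x (_ | ⟨_, hx⟩)
      exacts [h, h.trans (hal x hx)]
    · subst h
      exact ⟨l, hl', fun x hx => Or.inr (List.mem_cons_of_mem _ hx), -1, by
        rw [List.map_cons, List.prod_cons, ← mul_assoc, gen_mul_self]; simp⟩
    · obtain ⟨m, hm, hmem, s, hs⟩ := ih hl'
      refine ⟨a :: m, List.pairwise_cons.2 ⟨fun x hx => ?_, hm⟩, fun x hx => ?_, -s, ?_⟩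
      · rcases hmem x hx with rfl | hx
        exacts [h, hal x hx]
      · rcases List.mem_cons.1 hx with rfl | hx
        · simp
        · rcases hmem x hx with rfl | hx <;> simp [*]
      · rw [List.map_cons, List.prod_cons, ← mul_assoc, gen_mul_gen h.ne', neg_mul, mul_assoc, hs,
          List.map_cons, List.prod_cons, mul_smul_comm, neg_smul]

theorem span_monomial : Submodule.span ℝ (Set.range (monomial (n := n))) = ⊤ := by
  refine Submodule.eq_top_iff'.2 fun X => ?_
  have key (j : Fin n) (Y : Cl n) (hY : Y ∈ Submodule.span ℝ (Set.range (monomial (n := n)))) :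
      gen j * Y ∈ Submodule.span ℝ (Set.range (monomial (n := n))) := by
    induction hY using Submodule.span_induction with
    | mem Y h =>
      obtain ⟨I, rfl⟩ := h
      obtain ⟨l, hl, -, s, hs⟩ := gen_mul_prod_gen j (I.sort (· ≤ ·))
        (Finset.sortedLT_sort I).pairwise
      rw [monomial, hs, ← monomial_toFinset hl]
      exact Submodule.smul_mem _ _ (Submodule.subset_span ⟨_, rfl⟩)
    | zero => simp
    | add a b _ _ ha hb => rw [mul_add]; exact Submodule.add_mem _ ha hb
    | smul r a _ ha => rw [mul_smul_comm]; exact Submodule.smul_mem _ _ ha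
  induction X using CliffordAlgebra.left_induction with
  | algebraMap r =>
    rw [Algebra.algebraMap_eq_smul_one, ← monomial_empty]
    exact Submodule.smul_mem _ _ (Submodule.subset_span ⟨_, rfl⟩)
  | add a b ha hb => exact Submodule.add_mem _ ha hb
  | ι_mul a v ha =>
    rw [ι_eq_sum_gen, Finset.sum_mul]
    refine Submodule.sum_mem _ fun j _ => ?_
    rw [smul_mul_assoc]
    exact Submodule.smul_mem _ _ (key j a ha)

theorem monomial_ne_zero (I : Finset (Fin n)) : monomial I ≠ 0 := by
  have key (l : List (Fin n)) : IsUnit ((l.map gen).prod : Cl n) := by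
    induction l with
    | nil => simp
    | cons j l ih =>
      rw [List.map_cons, List.prod_cons]
      refine IsUnit.mul ⟨⟨gen j, -gen j, ?_, ?_⟩, rfl⟩ ih
      · rw [mul_neg, gen_mul_self, neg_neg]
      · rw [neg_mul, gen_mul_self, neg_neg]
  have : Invertible (2 : ℝ) := invertibleOfNonzero two_ne_zero
  have : Nontrivial (Cl n) := inferInstance
  exact (key _).ne_zero

/-- The monomials are joint eigenvectors of the sign changes `flip j`. Weighting these by `2 ^ j`
gives one operator whose eigenvalues separate the subsets, by uniqueness of binary expansions. -/
theorem linearIndependent_monomial : LinearIndependent ℝ (monomial (n := n)) := by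
  let T : Module.End ℝ (Cl n) := ∑ j : Fin n, (2 : ℝ) ^ (j : ℕ) • (flip j).toLinearMap
  refine T.eigenvectors_linearIndependent'
    (fun I => ∑ j : Fin n, (2 : ℝ) ^ (j : ℕ) * if j ∈ I then -1 else 1)
    (fun I J h => ?_) _ fun I => ?_
  · have hsum (K : Finset (Fin n)) : (∑ j : Fin n, (2 : ℝ) ^ (j : ℕ) * if j ∈ K then -1 else 1) =
        (∑ j : Fin n, (2 : ℝ) ^ (j : ℕ)) - 2 * ((∑ k ∈ K.map Fin.valEmbedding, 2 ^ k : ℕ) : ℝ) := by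
      rw [Finset.sum_map, Nat.cast_sum, ← Finset.univ_inter K, ← Finset.sum_ite_mem,
        Finset.mul_sum, ← Finset.sum_sub_distrib]
      refine Finset.sum_congr rfl fun j _ => ?_
      by_cases h : j ∈ K
      · simp [h]; ring
      · simp [h]
    simp only [hsum] at h
    have h' : ((∑ k ∈ I.map Fin.valEmbedding, 2 ^ k : ℕ) : ℝ) =
      ((∑ k ∈ J.map Fin.valEmbedding, 2 ^ k : ℕ) : ℝ) := by linarith
    exact Finset.map_injective _ (Finset.geomSum_injective le_rfl (Nat.cast_injective h'))
  · refine ⟨Module.End.mem_eigenspace_iff.2 ?_, monomial_ne_zero I⟩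
    simp [T, LinearMap.sum_apply, flip_monomial, Finset.sum_smul]

/-- The basis of `Cl_{0,n}` that consists of the monomials. -/
def monomialBasis (n : ℕ) : Module.Basis (Finset (Fin n)) ℝ (Cl n) :=
  Module.Basis.mk linearIndependent_monomial span_monomial.ge

theorem monomialBasis_apply (I : Finset (Fin n)) : monomialBasis n I = monomial I := by
  simp [monomialBasis]

theorem repr_flip (j : Fin n) (X : Cl n) (I : Finset (Fin n)) :
    (monomialBasis n).repr (flip j X) I =
      (if j ∈ I then -1 else 1) * (monomialBasis n).repr X I := by
  have : (monomialBasis n).coord I ∘ₗ (flip j).toLinearMap =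
      (if j ∈ I then (-1 : ℝ) else 1) • (monomialBasis n).coord I := by
    refine (monomialBasis n).ext fun J => ?_
    simp only [LinearMap.comp_apply, AlgHom.toLinearMap_apply, monomialBasis_apply, flip_monomial,
      LinearMap.smul_apply, map_smul]
    rw [← monomialBasis_apply, Module.Basis.coord_apply, Module.Basis.repr_self]
    by_cases h : J = I
    · rw [h]
    · simp [h]
  exact LinearMap.congr_fun this X

theorem span_monomial_eq (p : Finset (Fin n) → Prop) :
    Submodule.span ℝ {x | ∃ I, p I ∧ x = monomial I} =
      Submodule.span ℝ (monomialBasis n '' {I | p I}) := by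
  congr 1
  ext x
  simp only [Set.mem_image, Set.mem_ofPred_eq, monomialBasis_apply, eq_comm]

theorem mem_degreeLE_iff {k : ℕ} {X : Cl n} :
    X ∈ degreeLE n k ↔ ∀ I, (monomialBasis n).repr X I ≠ 0 → I.card ≤ k := by
  rw [degreeLE, span_monomial_eq fun I => I.card ≤ k, Module.Basis.mem_span_image]
  simp [Set.subset_def]

theorem monomial_mem_degreeLE {k : ℕ} {I : Finset (Fin n)} (h : I.card ≤ k) :
    monomial I ∈ degreeLE n k := Submodule.subset_span ⟨I, h, rfl⟩

theorem scalars_eq_span : scalars n = Submodule.span ℝ (monomialBasis n '' {I | I.card = 0}) := by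
  simp only [Finset.card_eq_zero, Set.ofPred_eq_eq_singleton, Set.image_singleton,
    monomialBasis_apply, monomial_empty]
  ext x
  simp [scalars, Submodule.mem_span_singleton, Algebra.algebraMap_eq_smul_one]

theorem vectors_eq_span_monomial :
    vectors n = Submodule.span ℝ (monomialBasis n '' {I | I.card = 1}) := by
  rw [vectors_eq_span]
  congr 1
  ext x
  simp only [Set.mem_image, Set.mem_ofPred_eq, Finset.card_eq_one, Set.mem_range,
    monomialBasis_apply]
  constructor
  · rintro ⟨j, rfl⟩
    exact ⟨{j}, ⟨j, rfl⟩, monomial_singleton j⟩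
  · rintro ⟨_, ⟨j, rfl⟩, rfl⟩
    exact ⟨j, (monomial_singleton j).symm⟩

theorem bivectors_eq_span :
    bivectors n = Submodule.span ℝ (monomialBasis n '' {I | I.card = 2}) :=
  span_monomial_eq fun I => I.card = 2

theorem degreeLE_two_eq : degreeLE n 2 = scalars n ⊔ vectors n ⊔ bivectors n := by
  rw [degreeLE, span_monomial_eq fun I => I.card ≤ 2, scalars_eq_span, vectors_eq_span_monomial,
    bivectors_eq_span, ← Submodule.span_union, ← Submodule.span_union, ← Set.image_union,
    ← Set.image_union]
  congr 2
  ext I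
  simp only [Set.mem_ofPred_eq, Set.mem_union]
  omega

theorem iSupIndep_scalars_vectors_bivectors :
    iSupIndep ![scalars n, vectors n, bivectors n] := by
  have h : ![scalars n, vectors n, bivectors n] = fun k : Fin 3 =>
      Submodule.span ℝ (monomialBasis n '' {I | I.card = k}) := by
    ext1 k
    fin_cases k
    exacts [scalars_eq_span, vectors_eq_span_monomial, bivectors_eq_span]
  rw [h]
  intro k
  refine Disjoint.mono_right ?_ ((monomialBasis n).linearIndependent.disjoint_span_image
    (s := {I | I.card = k}) (t := {I | I.card = k}ᶜ) disjoint_compl_right)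
  refine iSup₂_le fun j hj => Submodule.span_mono (Set.image_mono fun I hI hk => hj ?_)
  exact Fin.ext (hI.symm.trans hk)

theorem mul_gen_mem_degreeLE_two {x : Cl n} (hx : x ∈ paravectors n) (j : Fin n) :
    x * gen j ∈ degreeLE n 2 := by
  obtain ⟨_, ⟨r, rfl⟩, _, ⟨v, rfl⟩, rfl⟩ := Submodule.mem_sup.1 hx
  rw [add_mul, ι_eq_sum_gen, Finset.sum_mul, Algebra.linearMap_apply, ← Algebra.smul_def]
  refine Submodule.add_mem _ (Submodule.smul_mem _ _ ?_) (Submodule.sum_mem _ fun k _ => ?_)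
  · rw [← monomial_singleton]
    exact monomial_mem_degreeLE (by simp)
  · rw [smul_mul_assoc]
    refine Submodule.smul_mem _ _ ?_
    rcases lt_trichotomy j k with h | rfl | h
    · rw [gen_mul_gen h.ne', ← monomial_pair h]
      exact Submodule.neg_mem _ (monomial_mem_degreeLE Finset.card_le_two)
    · rw [gen_mul_self, ← monomial_empty]
      exact Submodule.neg_mem _ (monomial_mem_degreeLE (by simp))
    · rw [← monomial_pair h]
      exact monomial_mem_degreeLE Finset.card_le_two

/-- By `gen_mul_involute`, the twisted commutator with `i_j`, multiplied by `i_j` on the right, is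
`-(X - flip j X)`. Up to sign this doubles the coefficients of the monomials containing `i_j`, and
it has degree at most two. -/
theorem mem_degreeLE_two_of_commutator {X : Cl n}
    (h : ∀ x ∈ paravectors n, X * x - x * CliffordAlgebra.involute X ∈ paravectors n) :
    X ∈ degreeLE n 2 := by
  rw [mem_degreeLE_iff]
  intro I hI
  by_contra! hcard
  obtain ⟨j, hj⟩ : I.Nonempty := Finset.card_pos.1 (by omega)
  have hmem := mul_gen_mem_degreeLE_two
    (h (gen j) (Submodule.mem_sup_right (gen_mem_vectors j))) j
  rw [gen_mul_involute, ← sub_mul, mul_assoc, gen_mul_self, mul_neg, mul_one,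
    mem_degreeLE_iff] at hmem
  have := hmem I (by simp [repr_flip, hj]; intro h0; apply hI; linarith)
  omega

end Cl

/-! ### The twisted action on paravectors and explicit group elements. -/

namespace Cl
variable {n : ℕ}

theorem algebraMap_mem_paravectors (r : ℝ) : algebraMap ℝ (Cl n) r ∈ paravectors n :=
  Submodule.mem_sup_left ⟨r, rfl⟩

theorem ι_mem_paravectors (v : Fin n → ℝ) :
    CliffordAlgebra.ι (negDefForm n) v ∈ paravectors n :=
  Submodule.mem_sup_right ⟨v, rfl⟩

theorem mem_paravectors_iff {x : Cl n} : x ∈ paravectors n ↔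
    ∃ (r : ℝ) (v : Fin n → ℝ), x = algebraMap ℝ (Cl n) r + CliffordAlgebra.ι (negDefForm n) v := by
  constructor
  · intro hx
    obtain ⟨_, ⟨r, rfl⟩, _, ⟨v, rfl⟩, rfl⟩ := Submodule.mem_sup.1 hx
    exact ⟨r, v, rfl⟩
  · rintro ⟨r, v, rfl⟩
    exact add_mem (algebraMap_mem_paravectors r) (ι_mem_paravectors v)

theorem involute_mem_paravectors {x : Cl n} (hx : x ∈ paravectors n) :
    CliffordAlgebra.involute x ∈ paravectors n := by
  obtain ⟨r, v, rfl⟩ := mem_paravectors_iff.1 hx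
  rw [map_add, AlgHom.commutes, CliffordAlgebra.involute_ι]
  exact add_mem (algebraMap_mem_paravectors r) (neg_mem (ι_mem_paravectors v))

theorem mul_involute_of_mem_paravectors {x : Cl n} (hx : x ∈ paravectors n) :
    ∃ r : ℝ, x * CliffordAlgebra.involute x = algebraMap ℝ (Cl n) r := by
  obtain ⟨r, v, rfl⟩ := mem_paravectors_iff.1 hx
  refine ⟨r * r - negDefForm n v, ?_⟩
  rw [map_add, AlgHom.commutes, CliffordAlgebra.involute_ι, map_sub, map_mul,
    ← CliffordAlgebra.ι_sq_scalar]
  simp only [Algebra.algebraMap_eq_smul_one, add_mul, mul_add, smul_mul_assoc, mul_smul_comm,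
    one_mul, mul_one, mul_neg]
  module

/-- After expansion, the only products of vectors are `a b + b a` and `a a`, which are scalars, and
`a b a`, which is a vector. -/
theorem mul_mul_mem_paravectors {x y : Cl n} (hx : x ∈ paravectors n) (hy : y ∈ paravectors n) :
    x * y * x ∈ paravectors n := by
  obtain ⟨r, v, rfl⟩ := mem_paravectors_iff.1 hx
  obtain ⟨s, w, rfl⟩ := mem_paravectors_iff.1 hy
  set a := CliffordAlgebra.ι (negDefForm n) v
  set b := CliffordAlgebra.ι (negDefForm n) w
  have h : (algebraMap ℝ (Cl n) r + a) * (algebraMap ℝ (Cl n) s + b) * (algebraMap ℝ (Cl n) r + a) =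
      algebraMap ℝ (Cl n) (r * r * s) + (r * r) • b + (2 * r * s) • a + r • (a * b + b * a)
        + s • (a * a) + a * b * a := by
    simp only [Algebra.algebraMap_eq_smul_one, add_mul, mul_add, smul_mul_assoc, mul_smul_comm,
      one_mul, mul_one]
    module
  rw [h, CliffordAlgebra.ι_mul_ι_add_swap, CliffordAlgebra.ι_sq_scalar,
    CliffordAlgebra.ι_mul_ι_mul_ι]
  have h1 := algebraMap_mem_paravectors (n := n)
  have h2 := ι_mem_paravectors (n := n)
  exact add_mem (add_mem (add_mem (add_mem (add_mem (h1 _) (Submodule.smul_mem _ _ (h2 _)))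
    (Submodule.smul_mem _ _ (h2 _))) (Submodule.smul_mem _ _ (h1 _)))
    (Submodule.smul_mem _ _ (h1 _))) (h2 _)

theorem involute_inv_of_mem_paravectors {u : (Cl n)ˣ} (hu : (u : Cl n) ∈ paravectors n) :
    ∃ r : ℝ, CliffordAlgebra.involute (u : Cl n) = r • ((u⁻¹ : (Cl n)ˣ) : Cl n) ∧ r ≠ 0 := by
  obtain ⟨r, hr⟩ := mul_involute_of_mem_paravectors hu
  have h : CliffordAlgebra.involute (u : Cl n) = r • ((u⁻¹ : (Cl n)ˣ) : Cl n) := by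
    rw [← Units.inv_mul_cancel_left u (CliffordAlgebra.involute (u : Cl n)), hr,
      ← Algebra.commutes, ← Algebra.smul_def]
  refine ⟨r, h, ?_⟩
  rintro rfl
  have : Invertible (2 : ℝ) := invertibleOfNonzero two_ne_zero
  have : Nontrivial (Cl n) := inferInstance
  rw [zero_smul] at h
  exact u.ne_zero (CliffordAlgebra.involute_involutive.injective (h.trans (map_zero _).symm))

theorem inv_mem_paravectors {u : (Cl n)ˣ} (hu : (u : Cl n) ∈ paravectors n) :
    ((u⁻¹ : (Cl n)ˣ) : Cl n) ∈ paravectors n := by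
  obtain ⟨r, hr, h0⟩ := involute_inv_of_mem_paravectors hu
  rw [← inv_smul_smul₀ h0 ((u⁻¹ : (Cl n)ˣ) : Cl n), ← hr]
  exact Submodule.smul_mem _ _ (involute_mem_paravectors hu)

/-- Since `û = r u⁻¹`, the twisted action of `u` is `x ↦ r⁻¹ u x u`. -/
theorem mul_mul_involute_inv_mem {u : (Cl n)ˣ} (hu : (u : Cl n) ∈ paravectors n) {x : Cl n}
    (hx : x ∈ paravectors n) :
    (u : Cl n) * x * CliffordAlgebra.involute ((u⁻¹ : (Cl n)ˣ) : Cl n) ∈ paravectors n := by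
  obtain ⟨r, hr, h0⟩ := involute_inv_of_mem_paravectors hu
  rw [← inv_smul_smul₀ h0 ((u⁻¹ : (Cl n)ˣ) : Cl n), ← hr, map_smul,
    CliffordAlgebra.involute_involute, mul_smul_comm]
  exact Submodule.smul_mem _ _ (mul_mul_mem_paravectors hu hx)

/-- The invertible elements `u` for which `x ↦ u x û⁻¹`, where `û` is the grade involution of `u`,
maps the paravectors onto the paravectors. -/
def twistedStabilizer (n : ℕ) : Subgroup (Cl n)ˣ where
  carrier := {u |
    (∀ x ∈ paravectors n,
      (u : Cl n) * x * CliffordAlgebra.involute ((u⁻¹ : (Cl n)ˣ) : Cl n) ∈ paravectors n) ∧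
    ∀ x ∈ paravectors n,
      ((u⁻¹ : (Cl n)ˣ) : Cl n) * x * CliffordAlgebra.involute (u : Cl n) ∈ paravectors n}
  mul_mem' {u v} hu hv := by
    refine ⟨fun x hx => ?_, fun x hx => ?_⟩
    · have := hu.1 _ (hv.1 x hx)
      simpa only [mul_inv_rev, Units.val_mul, map_mul, mul_assoc] using this
    · have := hv.2 _ (hu.2 x hx)
      simpa only [mul_inv_rev, Units.val_mul, map_mul, mul_assoc] using this
  one_mem' := by simp
  inv_mem' {u} hu := ⟨hu.2, by simpa only [inv_inv] using hu.1⟩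

theorem lipschitzGroup_le_twistedStabilizer : lipschitzGroup n ≤ twistedStabilizer n := by
  refine (Subgroup.closure_le _).2 fun u hu => ⟨fun x hx => mul_mul_involute_inv_mem hu hx,
    fun x hx => ?_⟩
  have := mul_mul_involute_inv_mem (u := u⁻¹) (inv_mem_paravectors hu) hx
  rwa [inv_inv] at this

theorem exists_mem_lipschitzGroup_of_mem_paravectors {x : Cl n} (hx : x ∈ paravectors n) {r : ℝ}
    (h : x * CliffordAlgebra.involute x = algebraMap ℝ (Cl n) r)
    (h' : CliffordAlgebra.involute x * x = algebraMap ℝ (Cl n) r) (hr : r ≠ 0) :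
    ∃ g ∈ lipschitzGroup n, (g : Cl n) = x :=
  ⟨⟨x, r⁻¹ • CliffordAlgebra.involute x,
    by rw [mul_smul_comm, h, Algebra.algebraMap_eq_smul_one, inv_smul_smul₀ hr],
    by rw [smul_mul_assoc, h', Algebra.algebraMap_eq_smul_one, inv_smul_smul₀ hr]⟩,
    Subgroup.subset_closure hx, rfl⟩

theorem exists_mem_lipschitzGroup_one_add_smul_gen (t : ℝ) (j : Fin n) :
    ∃ g ∈ lipschitzGroup n, (g : Cl n) = 1 + t • gen j := by
  have hi : CliffordAlgebra.involute (1 + t • gen j : Cl n) = 1 - t • gen j := by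
    rw [map_add, map_one, map_smul, gen, CliffordAlgebra.involute_ι, smul_neg, sub_eq_add_neg]
  have e : (t • gen j : Cl n) * (t • gen j) = -algebraMap ℝ (Cl n) (t * t) := by
    rw [smul_mul_smul_comm, gen_mul_self, Algebra.algebraMap_eq_smul_one, smul_neg]
  refine exists_mem_lipschitzGroup_of_mem_paravectors (r := 1 + t * t)
    (add_mem (by simpa using algebraMap_mem_paravectors (n := n) 1)
      (Submodule.smul_mem _ _ (ι_mem_paravectors _))) ?_ ?_ (by nlinarith [mul_self_nonneg t]) <;>
  · rw [hi, map_add, map_one]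
    simp only [add_mul, mul_sub, sub_mul, mul_add, one_mul, mul_one, e]
    abel

/-- The element factors into vectors as `i_j (-i_j + t i_k)`. -/
theorem exists_mem_lipschitzGroup_one_add_smul_gen_mul_gen (t : ℝ) {j k : Fin n} (h : j ≠ k) :
    ∃ g ∈ lipschitzGroup n, (g : Cl n) = 1 + t • (gen j * gen k) := by
  have hP (l : Fin n) : (gen l : Cl n) ∈ paravectors n := ι_mem_paravectors _
  have hi (l : Fin n) : CliffordAlgebra.involute (gen l : Cl n) = -gen l :=
    CliffordAlgebra.involute_ι _
  obtain ⟨g, hg, hgj⟩ : ∃ g ∈ lipschitzGroup n, (g : Cl n) = gen j :=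
    exists_mem_lipschitzGroup_of_mem_paravectors (r := 1) (hP j)
      (by rw [hi, mul_neg, gen_mul_self, neg_neg, map_one])
      (by rw [hi, neg_mul, gen_mul_self, neg_neg, map_one]) one_ne_zero
  have e : (-gen j + t • gen k : Cl n) * (-gen j + t • gen k) =
      -algebraMap ℝ (Cl n) (1 + t * t) := by
    simp only [add_mul, mul_add, neg_mul, mul_neg, smul_mul_assoc, mul_smul_comm, gen_mul_self,
      gen_mul_gen h, Algebra.algebraMap_eq_smul_one]
    module
  obtain ⟨g', hg', hgk⟩ : ∃ g ∈ lipschitzGroup n, (g : Cl n) = -gen j + t • gen k := by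
    refine exists_mem_lipschitzGroup_of_mem_paravectors (r := 1 + t * t)
      (add_mem (neg_mem (hP j)) (Submodule.smul_mem _ _ (hP k))) ?_ ?_
      (by nlinarith [mul_self_nonneg t])
    · rw [map_add, map_neg, map_smul, hi, hi, smul_neg, ← neg_add, mul_neg, e, neg_neg]
    · rw [map_add, map_neg, map_smul, hi, hi, smul_neg, ← neg_add, neg_mul, e, neg_neg]
  refine ⟨g * g', mul_mem hg hg', ?_⟩
  rw [Units.val_mul, hgj, hgk, mul_add, mul_neg, gen_mul_self, neg_neg, mul_smul_comm]

theorem exists_mem_lipschitzGroup_one_add_smul_monomial {I : Finset (Fin n)} (hI : I.card ≤ 2)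
    {t : ℝ} (ht : |t| < 1) : ∃ g ∈ lipschitzGroup n, (g : Cl n) = 1 + t • monomial I := by
  obtain h | h | h : I.card = 0 ∨ I.card = 1 ∨ I.card = 2 := by omega
  · rw [Finset.card_eq_zero.1 h, monomial_empty]
    have h1 : (1 + t • 1 : Cl n) = algebraMap ℝ (Cl n) (1 + t) := by
      rw [map_add, map_one, Algebra.algebraMap_eq_smul_one]
    -- The scalar case is the only one that needs `|t| < 1`.
    have h0 : 1 + t ≠ 0 := by linarith [(abs_lt.1 ht).1]
    rw [h1]
    refine exists_mem_lipschitzGroup_of_mem_paravectors (r := (1 + t) * (1 + t))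
      (algebraMap_mem_paravectors _) ?_ ?_ (mul_ne_zero h0 h0) <;>
    rw [AlgHom.commutes, map_mul]
  · obtain ⟨j, rfl⟩ := Finset.card_eq_one.1 h
    rw [monomial_singleton]
    exact exists_mem_lipschitzGroup_one_add_smul_gen t j
  · obtain ⟨j, k, hjk, rfl⟩ := Finset.card_eq_two.1 h
    rcases hjk.lt_or_gt with h | h
    · rw [monomial_pair h]
      exact exists_mem_lipschitzGroup_one_add_smul_gen_mul_gen t hjk
    · rw [Finset.pair_comm, monomial_pair h]
      exact exists_mem_lipschitzGroup_one_add_smul_gen_mul_gen t hjk.symm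

end Cl

/-! ### Exponential and logarithm in a Banach algebra. -/

theorem hasStrictFDerivAt_list_prod_one_add_smul {A : Type*} [NormedRing A]
    [NormedAlgebra ℝ A] {ι : Type*} [Fintype ι] (b : ι → A) (l : List ι) :
    HasStrictFDerivAt (fun t : ι → ℝ => (l.map fun i => 1 + t i • b i).prod)
      (l.map fun i =>
        (ContinuousLinearMap.proj (R := ℝ) (φ := fun _ : ι => ℝ) i).smulRight (b i)).sum 0 := by
  induction l with
  | nil => simpa using hasStrictFDerivAt_const _ _
  | cons a l ih =>
    have h1 : HasStrictFDerivAt (fun t : ι → ℝ => 1 + t a • b a)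
        ((ContinuousLinearMap.proj (R := ℝ) (φ := fun _ : ι => ℝ) a).smulRight (b a)) 0 :=
      (((ContinuousLinearMap.proj (R := ℝ) (φ := fun _ : ι => ℝ) a).smulRight
        (b a)).hasStrictFDerivAt).const_add 1
    simp only [List.map_cons, List.prod_cons, List.sum_cons]
    refine (h1.mul' ih).congr_fderiv ?_
    ext t
    simp [add_comm]

section BanachAlgebra

variable {A : Type*} [NormedRing A] [NormedAlgebra ℝ A] [CompleteSpace A]

theorem contDiff_normedSpace_exp {k : ℕ∞ω} : ContDiff ℝ k (NormedSpace.exp : A → A) :=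
  contDiff_iff_contDiffAt.2 fun x =>
    let _ := NormedAlgebra.restrictScalars ℚ ℝ A
    (NormedSpace.exp_analytic (𝕂 := ℝ) x).contDiffAt

variable (A) in
/-- The exponential map of a Banach algebra as a local diffeomorphism at `0`. -/
def expLocalDiffeo : OpenPartialHomeomorph A A :=
  (contDiff_normedSpace_exp.contDiffAt.toOpenPartialHomeomorph (n := ω) NormedSpace.exp
    (f' := ContinuousLinearEquiv.refl ℝ A) (hasFDerivAt_exp_zero (𝕂 := ℝ))
    (by simp)).restrContDiff ℝ ω (by simp)

theorem expLocalDiffeo_apply (X : A) : expLocalDiffeo A X = NormedSpace.exp X := rfl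

theorem zero_mem_expLocalDiffeo_source : (0 : A) ∈ (expLocalDiffeo A).source := by
  have h := contDiff_normedSpace_exp.contDiffAt (n := ω) (x := (0 : A))
  have h' : HasFDerivAt (NormedSpace.exp : A → A)
    (ContinuousLinearEquiv.refl ℝ A : A →L[ℝ] A) 0 := hasFDerivAt_exp_zero (𝕂 := ℝ)
  rw [expLocalDiffeo, OpenPartialHomeomorph.restrContDiff_source]
  exact ⟨h.mem_toOpenPartialHomeomorph_source h' (by simp), h, h.to_localInverse h' (by simp)⟩

theorem contDiffOn_expLocalDiffeo_symm {k : ℕ∞ω} :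
    ContDiffOn ℝ k (expLocalDiffeo A).symm (expLocalDiffeo A).target :=
  (OpenPartialHomeomorph.contDiffOn_restrContDiff_target ℝ _ (n := ω) (by simp)).of_le le_top

theorem one_mem_expLocalDiffeo_target : (1 : A) ∈ (expLocalDiffeo A).target := by
  have := (expLocalDiffeo A).map_source zero_mem_expLocalDiffeo_source
  rwa [expLocalDiffeo_apply, NormedSpace.exp_zero] at this

theorem expLocalDiffeo_symm_one : (expLocalDiffeo A).symm 1 = 0 := by
  have := (expLocalDiffeo A).left_inv zero_mem_expLocalDiffeo_source
  rwa [expLocalDiffeo_apply, NormedSpace.exp_zero] at this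

theorem hasStrictFDerivAt_expLocalDiffeo_symm :
    HasStrictFDerivAt (expLocalDiffeo A).symm (ContinuousLinearMap.id ℝ A) 1 := by
  have h1 : HasFDerivAt (expLocalDiffeo A).symm
      ((ContinuousLinearEquiv.refl ℝ A).symm : A →L[ℝ] A) 1 := by
    refine (expLocalDiffeo A).hasFDerivAt_symm one_mem_expLocalDiffeo_target ?_
    rw [expLocalDiffeo_symm_one]
    exact hasFDerivAt_exp_zero (𝕂 := ℝ)
  exact ((contDiffOn_expLocalDiffeo_symm (k := ω)).contDiffAt
    ((expLocalDiffeo A).open_target.mem_nhds one_mem_expLocalDiffeo_target)).hasStrictFDerivAt'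
    h1 (by simp)

/-- A closed subalgebra contains the small logarithms of its elements. -/
theorem Subalgebra.eventually_mem_of_exp_mem (S : Subalgebra ℝ A) (hS : IsClosed (S : Set A)) :
    ∀ᶠ X in 𝓝 (0 : A), NormedSpace.exp X ∈ S → X ∈ S := by
  have : CompleteSpace S := hS.completeSpace_coe
  have hs : ∀ᶠ s in 𝓝 (1 : S), s ∈ (expLocalDiffeo S).target ∧
      (((expLocalDiffeo S).symm s : S) : A) ∈ (expLocalDiffeo A).source := by
    refine ((expLocalDiffeo S).open_target.eventually_mem one_mem_expLocalDiffeo_target).and ?_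
    have hc : ContinuousAt (fun s => (((expLocalDiffeo S).symm s : S) : A)) 1 :=
      continuous_subtype_val.continuousAt.comp
        ((expLocalDiffeo S).continuousAt_symm one_mem_expLocalDiffeo_target)
    refine hc.eventually_mem ((expLocalDiffeo A).open_source.mem_nhds ?_)
    rw [expLocalDiffeo_symm_one]
    exact zero_mem_expLocalDiffeo_source
  rw [nhds_subtype_eq_comap, eventually_comap] at hs
  have he : Tendsto (NormedSpace.exp : A → A) (𝓝 0) (𝓝 ((1 : S) : A)) := by
    have := (contDiff_normedSpace_exp (A := A) (k := 1)).continuous.tendsto 0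
    rwa [NormedSpace.exp_zero] at this
  filter_upwards [he.eventually hs,
    (expLocalDiffeo A).open_source.mem_nhds zero_mem_expLocalDiffeo_source] with X hX hX' hXS
  obtain ⟨h1, h2⟩ := hX ⟨_, hXS⟩ rfl
  have h3 := (expLocalDiffeo S).right_inv h1
  rw [expLocalDiffeo_apply] at h3
  have h4 := congrArg S.val h3
  let _ := NormedAlgebra.restrictScalars ℚ ℝ S
  let _ := NormedAlgebra.restrictScalars ℚ ℝ A
  rw [NormedSpace.map_exp S.val continuous_subtype_val] at h4
  -- The logarithm taken inside `S` and `X` itself have the same exponential and both lie where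
  -- `exp` is injective.
  rw [← (expLocalDiffeo A).injOn h2 hX' h4]
  exact Subtype.mem _

theorem ContinuousLinearMap.exp_apply_of_pow {T : A →L[ℝ] A} {z w : A} {f : A →L[ℝ] A}
    (h : ∀ k : ℕ, (T ^ k) z = f (w ^ k)) : NormedSpace.exp T z = f (NormedSpace.exp w) := by
  have h1 := (NormedSpace.exp_series_hasSum_exp' (𝕂 := ℝ) T).mapL
    (ContinuousLinearMap.apply ℝ A z)
  have h2 := (NormedSpace.exp_series_hasSum_exp' (𝕂 := ℝ) w).mapL f
  simp only [map_smul, ContinuousLinearMap.apply_apply, h] at h1 h2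
  exact h1.unique h2

/-- Left and right multiplications commute, so the exponential of their difference splits into two
factors. -/
theorem exp_mul_sub_mul_apply (X Y x : A) :
    NormedSpace.exp (ContinuousLinearMap.mul ℝ A X - (ContinuousLinearMap.mul ℝ A).flip Y) x =
      NormedSpace.exp X * x * NormedSpace.exp (-Y) := by
  let _ := NormedAlgebra.restrictScalars ℚ ℝ (A →L[ℝ] A)
  have hc : Commute (ContinuousLinearMap.mul ℝ A X) (-(ContinuousLinearMap.mul ℝ A).flip Y) := by
    ext z; simp [mul_assoc]
  have h1 (z : A) : NormedSpace.exp (ContinuousLinearMap.mul ℝ A X) z = NormedSpace.exp X * z := by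
    refine ContinuousLinearMap.exp_apply_of_pow (f := (ContinuousLinearMap.mul ℝ A).flip z)
      fun k => ?_
    induction k with
    | zero => simp
    | succ k ih => rw [pow_succ', mul_apply_eq_comp, ih]; simp [pow_succ', mul_assoc]
  have h2 (z : A) : NormedSpace.exp (-(ContinuousLinearMap.mul ℝ A).flip Y) z =
      z * NormedSpace.exp (-Y) := by
    refine ContinuousLinearMap.exp_apply_of_pow (f := ContinuousLinearMap.mul ℝ A z) fun k => ?_
    induction k with
    | zero => simp
    | succ k ih => rw [pow_succ', mul_apply_eq_comp, ih]; simp [pow_succ, mul_assoc]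
  rw [sub_eq_add_neg, NormedSpace.exp_add_of_commute hc, mul_apply_eq_comp, h1, h2, mul_assoc]

/-- The products `F t` of the factors `1 + t i • b i` lie in `G`, so by `hG` their small logarithms
lie in the span `V`. The map `t ↦ log (F t)`, projected to `V`, has surjective derivative at `0`,
hence covers a neighbourhood of `0` in `V`. -/
theorem Subgroup.eventually_exists_eq_exp [FiniteDimensional ℝ A] {ι : Type*} [Fintype ι]
    (G : Subgroup Aˣ) (b : ι → A)
    (hb : ∀ i, ∀ᶠ t : ℝ in 𝓝 0, ∃ g ∈ G, (g : A) = 1 + t • b i)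
    (hG : ∀ᶠ X in 𝓝 (0 : A), ∀ g ∈ G, (g : A) = NormedSpace.exp X →
      X ∈ Submodule.span ℝ (Set.range b)) :
    ∀ᶠ X in 𝓝 (0 : A), X ∈ Submodule.span ℝ (Set.range b) →
      ∃ g ∈ G, (g : A) = NormedSpace.exp X := by
  set V := Submodule.span ℝ (Set.range b)
  let F : (ι → ℝ) → A := fun t => ((Finset.univ.toList).map fun i => 1 + t i • b i).prod
  have hF := hasStrictFDerivAt_list_prod_one_add_smul b Finset.univ.toList
  rw [Finset.sum_map_toList] at hF
  have hF0 : F 0 = 1 := by simp [F]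
  have hFG : ∀ᶠ t in 𝓝 (0 : ι → ℝ), ∃ g ∈ G, (g : A) = F t := by
    have : ∀ᶠ t in 𝓝 (0 : ι → ℝ), ∀ i, ∃ g ∈ G, (g : A) = 1 + t i • b i :=
      eventually_all.2 fun i => ((continuous_apply i).tendsto (0 : ι → ℝ)).eventually (hb i)
    filter_upwards [this] with t ht
    have key (l : List ι) : ∃ g ∈ G, (g : A) = (l.map fun i => 1 + t i • b i).prod := by
      induction l with
      | nil => exact ⟨1, one_mem _, by simp⟩
      | cons i l ih =>
        obtain ⟨g, hg, h⟩ := ht i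
        obtain ⟨g', hg', h'⟩ := ih
        exact ⟨g * g', mul_mem hg hg', by simp [h, h']⟩
    exact key _
  obtain ⟨pr, hpr⟩ : V.ClosedComplemented := Submodule.ClosedComplemented.of_finiteDimensional V
  have hlog : HasStrictFDerivAt (expLocalDiffeo A).symm (ContinuousLinearMap.id ℝ A) (F 0) := by
    rw [hF0]; exact hasStrictFDerivAt_expLocalDiffeo_symm
  have hΦ := pr.hasStrictFDerivAt.comp 0 (hlog.comp 0 hF)
  have hmap := hΦ.map_nhds_eq_of_surj (by
    refine LinearMap.range_eq_top.2 fun v => ?_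
    obtain ⟨c, hc⟩ := Submodule.mem_span_range_iff_exists_fun ℝ |>.1 v.2
    refine ⟨c, ?_⟩
    rw [← hpr v, ← hc]
    simp)
  have h0 : pr ((expLocalDiffeo A).symm (F 0)) = 0 := by
    rw [hF0, expLocalDiffeo_symm_one, map_zero]
  have hev : ∀ᶠ v : V in 𝓝 0, ∃ g ∈ G, (g : A) = NormedSpace.exp (v : A) := by
    rw [← h0]
    refine Eventually.filter_mono hmap.ge ?_
    rw [eventually_map]
    have hcF : Tendsto F (𝓝 0) (𝓝 1) := by
      have := hF.continuousAt.tendsto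
      rwa [show ((Finset.univ.toList).map fun i => 1 + (0 : ι → ℝ) i • b i).prod = 1 from hF0]
        at this
    have hcl : Tendsto (expLocalDiffeo A).symm (𝓝 1) (𝓝 0) := by
      have := ((expLocalDiffeo A).continuousAt_symm one_mem_expLocalDiffeo_target).tendsto
      rwa [expLocalDiffeo_symm_one] at this
    filter_upwards [hFG, hcF.eventually
      ((expLocalDiffeo A).open_target.mem_nhds one_mem_expLocalDiffeo_target),
      (hcl.comp hcF).eventually hG] with t ⟨g, hg, hgt⟩ ht hGt
    have he : NormedSpace.exp ((expLocalDiffeo A).symm (F t)) = F t :=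
      (expLocalDiffeo A).right_inv ht
    have hV := hGt g hg (by rw [hgt, Function.comp_apply, he])
    refine ⟨g, hg, ?_⟩
    -- The logarithm is already in `V`, so the projection has not changed it.
    have : ((pr ((expLocalDiffeo A).symm (F t)) : V) : A) = (expLocalDiffeo A).symm (F t) :=
      congrArg Subtype.val (hpr ⟨_, hV⟩)
    change _ = NormedSpace.exp ((pr ((expLocalDiffeo A).symm (F t)) : V) : A)
    rw [this, he, hgt]
  rw [nhds_subtype_eq_comap, eventually_comap] at hev
  filter_upwards [hev] with X hX hXV
  exact hX ⟨X, hXV⟩ rfl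

end BanachAlgebra

/-! ### Logarithms of elements of the Lipschitz group. -/

namespace Cl

variable {n : ℕ}

/-- The twisted action of `exp X` is the exponential of `x ↦ X x - x X̂`. The operators preserving
the paravectors form a closed subalgebra, so for small `X` this operator belongs to it as well. -/
theorem eventually_mem_degreeLE_two_of_exp : ∀ᶠ X in 𝓝 (0 : Cl n),
    ∀ g ∈ lipschitzGroup n, (g : Cl n) = NormedSpace.exp X → X ∈ degreeLE n 2 := by
  have : CompleteSpace (Cl n) := FiniteDimensional.complete ℝ _
  let S : Subalgebra ℝ (Cl n →L[ℝ] Cl n) :=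
    { carrier := {T | ∀ x ∈ paravectors n, T x ∈ paravectors n}
      mul_mem' := fun {a b} ha hb x hx => ha _ (hb x hx)
      add_mem' := fun {a b} ha hb x hx => add_mem (ha x hx) (hb x hx)
      algebraMap_mem' := fun r x hx => by
        simpa [Algebra.algebraMap_eq_smul_one] using Submodule.smul_mem _ r hx }
  have hS : IsClosed (S : Set (Cl n →L[ℝ] Cl n)) := by
    have : (S : Set (Cl n →L[ℝ] Cl n)) =
        ⋂ x ∈ paravectors n, (fun T : Cl n →L[ℝ] Cl n => T x) ⁻¹' paravectors n := by
      ext T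
      simp only [Set.mem_iInter, Set.mem_preimage, SetLike.mem_coe]
      rfl
    rw [this]
    refine isClosed_biInter fun x _ =>
      (Submodule.closed_of_finiteDimensional (paravectors n)).preimage ?_
    exact (ContinuousLinearMap.apply ℝ (Cl n) x).continuous
  let inv : Cl n →L[ℝ] Cl n :=
    LinearMap.toContinuousLinearMap (CliffordAlgebra.involute (Q := negDefForm n)).toLinearMap
  have hcont : Continuous fun X : Cl n => ContinuousLinearMap.mul ℝ (Cl n) X -
      (ContinuousLinearMap.mul ℝ (Cl n)).flip (inv X) := by fun_prop
  have ht := hcont.tendsto 0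
  simp only [map_zero, sub_zero] at ht
  filter_upwards [ht.eventually (S.eventually_mem_of_exp_mem hS)] with X hX g hg hgX
  refine mem_degreeLE_two_of_commutator (hX fun x hx => ?_)
  have h1 := (lipschitzGroup_le_twistedStabilizer hg).1 x hx
  let _ := NormedAlgebra.restrictScalars ℚ ℝ (Cl n)
  have h2 : ((g⁻¹ : (Cl n)ˣ) : Cl n) = NormedSpace.exp (-X) := by
    refine Units.inv_eq_of_mul_eq_one_right ?_
    rw [hgX, ← NormedSpace.exp_add_of_commute (Commute.refl X).neg_right, add_neg_cancel,
      NormedSpace.exp_zero]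
  rw [exp_mul_sub_mul_apply, ← hgX]
  have h3 : NormedSpace.exp (-inv X) = CliffordAlgebra.involute ((g⁻¹ : (Cl n)ˣ) : Cl n) := by
    rw [h2, ← map_neg]
    exact (NormedSpace.map_exp (CliffordAlgebra.involute (Q := negDefForm n)) inv.continuous _).symm
  rwa [h3]

theorem eventually_exp_mem_lipschitzGroup_iff : ∀ᶠ X in 𝓝 (0 : Cl n),
    (∃ g ∈ lipschitzGroup n, (g : Cl n) = NormedSpace.exp X) ↔ X ∈ degreeLE n 2 := by
  have : CompleteSpace (Cl n) := FiniteDimensional.complete ℝ _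
  have hV : degreeLE n 2 =
      Submodule.span ℝ (Set.range fun I : {I : Finset (Fin n) // I.card ≤ 2} => monomial I.1) := by
    rw [degreeLE]
    congr 1
    ext x
    simp [eq_comm]
  have h1 := eventually_mem_degreeLE_two_of_exp (n := n)
  have h2 := (lipschitzGroup n).eventually_exists_eq_exp
    (fun I : {I : Finset (Fin n) // I.card ≤ 2} => (monomial I.1 : Cl n))
    (fun I => by
      filter_upwards [Metric.ball_mem_nhds (0 : ℝ) one_pos] with t ht
      exact exists_mem_lipschitzGroup_one_add_smul_monomial I.2 (by simpa using ht))
    (by rwa [← hV])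
  rw [← hV] at h2
  filter_upwards [h1, h2] with X h1 h2
  exact ⟨fun ⟨g, hg, h⟩ => h1 g hg h, h2⟩

end Cl

/-! ### Embedded Lie group structure from logarithmic charts. -/

section LinearGroup

variable {A : Type*} [NormedRing A]

/-- The inclusion in a Banach algebra of a subgroup of its group of units. -/
def Subgroup.unitsIncl (G : Subgroup Aˣ) (g : G) : A := ((g : Aˣ) : A)

theorem Subgroup.unitsIncl_mul (G : Subgroup Aˣ) (g h : G) :
    G.unitsIncl (g * h) = G.unitsIncl g * G.unitsIncl h := rfl

theorem Subgroup.isEmbedding_unitsIncl [CompleteSpace A] (G : Subgroup Aˣ) :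
    IsEmbedding G.unitsIncl :=
  Units.isOpenEmbedding_val.isEmbedding.comp .subtypeVal

variable [NormedAlgebra ℝ A]

/-- A linear parametrization of the logarithms of the elements near `1` of a subgroup of the
units of a Banach algebra. -/
structure Subgroup.ExpParam (G : Subgroup Aˣ) (E : Type*) [NormedAddCommGroup E]
    [NormedSpace ℝ E] where
  /-- The exponential map, restricted to a suitable neighbourhood of `0`. -/
  expLoc : OpenPartialHomeomorph A A
  expLoc_apply (X : A) : expLoc X = NormedSpace.exp X
  zero_mem : 0 ∈ expLoc.source
  contDiffOn_symm : ContDiffOn ℝ ∞ expLoc.symm expLoc.target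
  /-- The parametrization. -/
  param : E →L[ℝ] A
  /-- A linear retraction. -/
  proj : A →L[ℝ] E
  proj_param (v : E) : proj (param v) = v
  -- Every logarithm in the chosen neighbourhood of a group element lies in the image of `param`.
  param_proj (X : A) (hX : X ∈ expLoc.source) (g : G) (hg : G.unitsIncl g = expLoc X) :
    param (proj X) = X
  /-- The exponential map with values in the group. -/
  expGroup : E → G
  unitsIncl_expGroup (v : E) : G.unitsIncl (expGroup v) = expLoc (param v)

namespace Subgroup.ExpParam

variable {G : Subgroup Aˣ} {E : Type*} [NormedAddCommGroup E] [NormedSpace ℝ E]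
  (D : G.ExpParam E)

theorem one_mem : 1 ∈ D.expLoc.target := by
  have := D.expLoc.map_source D.zero_mem
  rwa [D.expLoc_apply, NormedSpace.exp_zero] at this

/-- The logarithmic chart of the Banach algebra at an element of the group. -/
def ambientChart (g : G) : OpenPartialHomeomorph A A :=
  (Homeomorph.smul ((g⁻¹ : G) : Aˣ)).transOpenPartialHomeomorph D.expLoc.symm

theorem ambientChart_apply (g : G) (x : A) :
    D.ambientChart g x = D.expLoc.symm (G.unitsIncl g⁻¹ * x) := rfl

variable [CompleteSpace A]

theorem contDiff_expLoc : ContDiff ℝ ∞ D.expLoc := by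
  have : (D.expLoc : A → A) = NormedSpace.exp := funext D.expLoc_apply
  rw [this]
  exact contDiff_normedSpace_exp

theorem continuous_expGroup : Continuous D.expGroup := by
  rw [G.isEmbedding_unitsIncl.continuous_iff]
  have : G.unitsIncl ∘ D.expGroup = D.expLoc ∘ D.param := funext D.unitsIncl_expGroup
  rw [this]
  exact D.contDiff_expLoc.continuous.comp D.param.continuous

/-- The logarithmic chart at the identity. -/
def chartOne : OpenPartialHomeomorph G E where
  toFun g := D.proj (D.expLoc.symm (G.unitsIncl g))
  invFun := D.expGroup
  source := G.unitsIncl ⁻¹' D.expLoc.target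
  target := D.param ⁻¹' D.expLoc.source
  map_source' g hg := by
    have h := D.param_proj _ (D.expLoc.map_target hg) g (D.expLoc.right_inv hg).symm
    rw [Set.mem_preimage, h]
    exact D.expLoc.map_target hg
  map_target' v hv := by
    rw [Set.mem_preimage, D.unitsIncl_expGroup]
    exact D.expLoc.map_source hv
  left_inv' g hg := by
    refine G.isEmbedding_unitsIncl.injective ?_
    rw [D.unitsIncl_expGroup,
      D.param_proj _ (D.expLoc.map_target hg) g (D.expLoc.right_inv hg).symm, D.expLoc.right_inv hg]
  right_inv' v hv := by
    rw [D.unitsIncl_expGroup, D.expLoc.left_inv hv, D.proj_param]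
  open_source := D.expLoc.open_target.preimage G.isEmbedding_unitsIncl.continuous
  open_target := D.expLoc.open_source.preimage D.param.continuous
  continuousOn_toFun := D.proj.continuous.comp_continuousOn
    (D.expLoc.continuousOn_symm.comp G.isEmbedding_unitsIncl.continuous.continuousOn
      fun _ h => h)
  continuousOn_invFun := D.continuous_expGroup.continuousOn

/-- The logarithmic chart at an arbitrary point. -/
def chart (g : G) : OpenPartialHomeomorph G E :=
  (Homeomorph.mulLeft g⁻¹).transOpenPartialHomeomorph D.chartOne

theorem chart_apply (g h : G) :
    D.chart g h = D.proj (D.expLoc.symm (G.unitsIncl (g⁻¹ * h))) := rfl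

theorem chart_source (g : G) :
    (D.chart g).source = {h | G.unitsIncl (g⁻¹ * h) ∈ D.expLoc.target} := rfl

theorem chart_target (g : G) : (D.chart g).target = D.param ⁻¹' D.expLoc.source := rfl

theorem chart_symm_apply (g : G) (v : E) : (D.chart g).symm v = g * D.expGroup v := by
  change (g⁻¹)⁻¹ * D.expGroup v = _
  rw [inv_inv]

/-- The atlas of logarithmic charts. -/
abbrev chartedSpace : ChartedSpace E G where
  atlas := Set.range D.chart
  chartAt := D.chart
  mem_chart_source g := by
    rw [chart_source, Set.mem_ofPred_eq, inv_mul_cancel]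
    exact D.one_mem
  chart_mem_atlas g := ⟨g, rfl⟩

theorem isManifold : letI := D.chartedSpace; IsManifold 𝓘(ℝ, E) ∞ G := by
  let _ := D.chartedSpace
  refine isManifold_of_contDiffOn _ _ _ ?_
  rintro _ _ ⟨g, rfl⟩ ⟨h, rfl⟩
  simp only [modelWithCornersSelf_coe, modelWithCornersSelf_coe_symm, Function.comp_id,
    Function.id_comp, Set.preimage_id, Set.range_id, Set.inter_univ]
  have heq : ((D.chart g).symm ≫ₕ D.chart h : E → E) = fun v =>
      D.proj (D.expLoc.symm (G.unitsIncl (h⁻¹ * g) * D.expLoc (D.param v))) := by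
    ext1 v
    rw [OpenPartialHomeomorph.coe_trans, Function.comp_apply, chart_symm_apply, chart_apply,
      ← mul_assoc, G.unitsIncl_mul, D.unitsIncl_expGroup]
  rw [heq]
  refine D.proj.contDiff.comp_contDiffOn (D.contDiffOn_symm.comp
    (contDiff_const.mul (D.contDiff_expLoc.comp D.param.contDiff)).contDiffOn fun v hv => ?_)
  have : (D.chart g).symm v ∈ (D.chart h).source := hv.2
  rwa [chart_symm_apply, chart_source, Set.mem_ofPred_eq, ← mul_assoc,
    G.unitsIncl_mul, D.unitsIncl_expGroup] at this

theorem ambientChart_mem_maximalAtlas (g : G) :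
    D.ambientChart g ∈ IsManifold.maximalAtlas 𝓘(ℝ, A) ∞ A := by
  rw [IsManifold.mem_maximalAtlas_iff_contMDiffOn, contMDiffOn_iff_contDiffOn,
    contMDiffOn_iff_contDiffOn]
  refine ⟨D.contDiffOn_symm.comp (contDiff_const.mul contDiff_id).contDiffOn fun x hx => hx,
    (contDiff_const.mul D.contDiff_expLoc).contDiffOn⟩

/-- In the logarithmic charts at `g` of the group and of the algebra, the inclusion is the linear
map `param`, which is split by `proj` with complement its kernel. -/
theorem isSmoothEmbedding : letI := D.chartedSpace;
    Manifold.IsSmoothEmbedding 𝓘(ℝ, E) 𝓘(ℝ, A) ∞ G.unitsIncl := by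
  let _ := D.chartedSpace
  have := D.isManifold
  refine ⟨Manifold.IsImmersionOfComplement.isImmersion (F := D.proj.ker) fun g => ?_,
    G.isEmbedding_unitsIncl⟩
  have hsrc (h : G) (hh : h ∈ (D.chart g).source) : G.unitsIncl h ∈ (D.ambientChart g).source := hh
  refine .mk_of_charts (ContinuousLinearEquiv.equivOfRightInverse D.proj D.param D.proj_param).symm
    (D.chart g) (D.ambientChart g) (mem_chart_source E g) (hsrc g (mem_chart_source E g))
    (IsManifold.chart_mem_maximalAtlas g) (D.ambientChart_mem_maximalAtlas g) hsrc ?_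
  intro v hv
  have hv' : D.param v ∈ D.expLoc.source := by
    simpa [chart_target] using hv
  simp only [Function.comp_apply, OpenPartialHomeomorph.extend_coe,
    OpenPartialHomeomorph.extend_coe_symm, modelWithCornersSelf_coe, modelWithCornersSelf_coe_symm,
    id, chart_symm_apply, ambientChart_apply, ← G.unitsIncl_mul, inv_mul_cancel_left,
    D.unitsIncl_expGroup, D.expLoc.left_inv hv']
  simp

/-- Smoothness into the group can be tested after the immersion, where the operations are those of
the algebra. -/
theorem lieGroup : letI := D.chartedSpace; LieGroup 𝓘(ℝ, E) ∞ G := by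
  let _ := D.chartedSpace
  have := D.isManifold
  have hi := D.isSmoothEmbedding
  have hs := hi.contMDiff
  exact
    { contMDiff_mul := by
        rw [ContMDiff.iff_comp_isImmersion hi.isImmersion]
        exact ⟨continuous_mul, contDiff_mul.contMDiff.comp
          ((hs.comp contMDiff_fst).prodMk_space (hs.comp contMDiff_snd))⟩
      contMDiff_inv := by
        rw [ContMDiff.iff_comp_isImmersion hi.isImmersion]
        refine ⟨continuous_inv, ?_⟩
        have : G.unitsIncl ∘ (fun g : G => g⁻¹) = Ring.inverse ∘ G.unitsIncl := by
          ext g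
          exact (Ring.inverse_unit (g : Aˣ)).symm
        rw [this]
        exact fun g => (contDiffAt_ringInverse ℝ (g : Aˣ)).contMDiffAt.comp g (hs g) }

end Subgroup.ExpParam

theorem Subgroup.nonempty_expParam [CompleteSpace A] [FiniteDimensional ℝ A]
    (G : Subgroup Aˣ) (V : Submodule ℝ A)
    (h : ∀ᶠ X in 𝓝 (0 : A), (∃ g ∈ G, (g : A) = NormedSpace.exp X) ↔ X ∈ V) :
    Nonempty (G.ExpParam (EuclideanSpace ℝ (Fin (Module.finrank ℝ V)))) := by
  obtain ⟨W, hW, hWo, hW0⟩ := eventually_nhds_iff.1 h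
  -- `exp X` is a power of `exp (X / (m + 1))`, so the local hypothesis puts all of `exp V` in `G`;
  -- `expGroup` has to be defined everywhere.
  have hexp (X : A) (hX : X ∈ V) : ∃ g ∈ G, (g : A) = NormedSpace.exp X := by
    have ht : Tendsto (fun m : ℕ => ((m : ℝ) + 1)⁻¹ • X) atTop (𝓝 0) := by
      have := tendsto_one_div_add_atTop_nhds_zero_nat (𝕜 := ℝ).smul_const X
      simpa using this
    obtain ⟨m, hm⟩ := (ht.eventually h).exists
    obtain ⟨g, hg, hgX⟩ := hm.2 (V.smul_mem _ hX)
    refine ⟨g ^ (m + 1), pow_mem hg _, ?_⟩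
    let _ := NormedAlgebra.restrictScalars ℚ ℝ A
    rw [Units.val_pow_eq_pow_val, hgX, ← NormedSpace.exp_nsmul, ← Nat.cast_smul_eq_nsmul ℝ,
      Nat.cast_succ, smul_inv_smul₀ (by positivity)]
  obtain ⟨pr, hpr⟩ : V.ClosedComplemented := Submodule.ClosedComplemented.of_finiteDimensional V
  let φ : EuclideanSpace ℝ (Fin (Module.finrank ℝ V)) ≃L[ℝ] V :=
    ContinuousLinearEquiv.ofFinrankEq (by simp)
  have hφ (v) : ∃ g : G, G.unitsIncl g = NormedSpace.exp (φ v : A) := by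
    obtain ⟨g, hg, hgv⟩ := hexp (φ v) (φ v).2
    exact ⟨⟨g, hg⟩, hgv⟩
  choose expG hexpG using hφ
  exact ⟨
    { expLoc := (expLocalDiffeo A).restrOpen W hWo
      expLoc_apply := fun _ => rfl
      zero_mem := ⟨zero_mem_expLocalDiffeo_source, hW0⟩
      contDiffOn_symm := contDiffOn_expLocalDiffeo_symm.mono fun x hx => hx.1
      param := V.subtypeL ∘L (φ : EuclideanSpace ℝ (Fin (Module.finrank ℝ V)) →L[ℝ] V)
      proj := (φ.symm : V →L[ℝ] EuclideanSpace ℝ (Fin (Module.finrank ℝ V))) ∘L pr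
      proj_param := fun v => by simp [hpr]
      param_proj := fun X hX g hg => by
        have hXV : X ∈ V := (hW X hX.2).1 ⟨g, g.2, hg⟩
        have := congrArg Subtype.val (hpr ⟨X, hXV⟩)
        simpa using this
      expGroup := expG
      unitsIncl_expGroup := hexpG }⟩

end LinearGroup

theorem Cl.exists_isEmbeddedLieGroup (n : ℕ) :
    ∃ (d : ℕ) (_ : ChartedSpace (EuclideanSpace ℝ (Fin d)) (Cl.lipschitzGroup n)),
      Cl.IsEmbeddedLieGroup n d := by
  have : CompleteSpace (Cl n) := FiniteDimensional.complete ℝ _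
  obtain ⟨D⟩ := (Cl.lipschitzGroup n).nonempty_expParam _ Cl.eventually_exp_mem_lipschitzGroup_iff
  refine ⟨_, D.chartedSpace, ?_⟩
  let _ := D.chartedSpace
  exact ⟨D.lieGroup, D.isSmoothEmbedding⟩

/-! ### Derivatives of immersions and velocities of curves. -/

section Immersion

variable {E : Type*} [NormedAddCommGroup E] [NormedSpace ℝ E] {F : Type*} [NormedAddCommGroup F]
  [NormedSpace ℝ F] {M : Type*} [TopologicalSpace M] [ChartedSpace E M]

/-- The derivative of an immersion of a manifold without boundary in a vector space is injective. -/
theorem Manifold.IsImmersionAt.mfderiv_injective {f : M → F} {x : M}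
    (hf : Manifold.IsImmersionAt 𝓘(ℝ, E) 𝓘(ℝ, F) ∞ f x) :
    Function.Injective (mfderiv 𝓘(ℝ, E) 𝓘(ℝ, F) f x) := by
  -- A local left inverse of `f`: in the charts, drop the complementary coordinate.
  let r : F → M := hf.domChart.symm ∘ fun y => (hf.equiv.symm (hf.codChart y)).1
  have hrf : ∀ y ∈ hf.domChart.source, hf.codChart (f y) = hf.equiv (hf.domChart y, 0) := by
    intro y hy
    have hy' : hf.domChart y ∈ (hf.domChart.extend 𝓘(ℝ, E)).target := by
      simpa using hf.domChart.map_source hy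
    simpa [hf.domChart.left_inv hy] using hf.writtenInCharts hy'
  have hr : ∀ y ∈ hf.domChart.source, r (f y) = y := by
    intro y hy
    simp only [r, Function.comp_apply, hrf y hy, ContinuousLinearEquiv.symm_apply_apply]
    exact hf.domChart.left_inv hy
  have hx := hf.mem_domChart_source
  have h1 : MDifferentiableAt 𝓘(ℝ, F) 𝓘(ℝ, E)
      (fun y => (hf.equiv.symm (hf.codChart y)).1) (f x) := by
    have h2 : DifferentiableAt ℝ hf.codChart (f x) :=
      ((contMDiffAt_of_mem_maximalAtlas hf.codChart_mem_maximalAtlas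
        hf.mem_codChart_source).mdifferentiableAt (by simp)).differentiableAt
    have h3 : DifferentiableAt ℝ (fun y => (hf.equiv.symm (hf.codChart y)).1) (f x) :=
      (hf.equiv.symm.differentiableAt.comp (f x) h2).fst
    exact h3.mdifferentiableAt
  have h2 : MDifferentiableAt 𝓘(ℝ, E) 𝓘(ℝ, E) hf.domChart.symm
      ((fun y => (hf.equiv.symm (hf.codChart y)).1) (f x)) := by
    refine (contMDiffAt_symm_of_mem_maximalAtlas hf.domChart_mem_maximalAtlas ?_).mdifferentiableAt
      (by simp)
    simp only [hrf x hx, ContinuousLinearEquiv.symm_apply_apply]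
    exact hf.domChart.map_source hx
  have hcomp := mfderiv_comp x (h2.comp (f x) h1) (hf.contMDiffAt.mdifferentiableAt (by simp))
  have hid : r ∘ f =ᶠ[𝓝 x] id :=
    Filter.eventuallyEq_of_mem (hf.domChart.open_source.mem_nhds hx) hr
  change mfderiv 𝓘(ℝ, E) 𝓘(ℝ, E) (r ∘ f) x = _ at hcomp
  rw [hid.mfderiv_eq, mfderiv_id] at hcomp
  intro v w hvw
  have hv := DFunLike.congr_fun hcomp v
  have hw := DFunLike.congr_fun hcomp w
  simp only [ContinuousLinearMap.comp_apply] at hv hw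
  rw [hvw] at hv
  exact hv.trans hw.symm

theorem MDifferentiableAt.hasFDerivAt_comp_extChartAt_symm {f : M → F} {x : M}
    (hf : MDifferentiableAt 𝓘(ℝ, E) 𝓘(ℝ, F) f x) :
    HasFDerivAt (f ∘ (extChartAt 𝓘(ℝ, E) x).symm) (mfderiv 𝓘(ℝ, E) 𝓘(ℝ, F) f x : E →L[ℝ] F)
      (extChartAt 𝓘(ℝ, E) x x) := by
  have key (g : E → F) (g' : E →L[ℝ] F) (u : E)
      (h : HasFDerivWithinAt g g' (Set.range 𝓘(ℝ, E)) u) : HasFDerivAt g g' u := by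
    rwa [ModelWithCorners.range_eq_univ, hasFDerivWithinAt_univ] at h
  exact key _ _ _ hf.hasMFDerivAt.2

/-- A vector in the image of the derivative of a map is the velocity of a curve in its image. -/
theorem MDifferentiableAt.exists_curve {f : M → F} {x : M}
    (hf : MDifferentiableAt 𝓘(ℝ, E) 𝓘(ℝ, F) f x) (v : TangentSpace 𝓘(ℝ, E) x) :
    ∃ c : ℝ → M, c 0 = x ∧ HasDerivAt (f ∘ c) (mfderiv 𝓘(ℝ, E) 𝓘(ℝ, F) f x v) 0 := by
  let w : E := v
  refine ⟨fun t => (extChartAt 𝓘(ℝ, E) x).symm (extChartAt 𝓘(ℝ, E) x x + t • w), by simp, ?_⟩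
  have h1 : HasDerivAt (fun t : ℝ => extChartAt 𝓘(ℝ, E) x x + t • w) w 0 := by
    simpa using ((hasDerivAt_id (0 : ℝ)).smul_const w).const_add (extChartAt 𝓘(ℝ, E) x x)
  exact HasFDerivAt.comp_hasDerivAt_of_eq (0 : ℝ) hf.hasFDerivAt_comp_extChartAt_symm h1 (by simp)

/-- The velocity of a smooth curve in the image of a smooth embedding is in the image of the
derivative of the embedding. -/
theorem Manifold.IsSmoothEmbedding.mem_range_mfderiv [IsManifold 𝓘(ℝ, E) ∞ M] {f : M → F}
    (hf : Manifold.IsSmoothEmbedding 𝓘(ℝ, E) 𝓘(ℝ, F) ∞ f) {c : ℝ → M}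
    (hc : ContDiffAt ℝ ∞ (f ∘ c) 0) {X : F} (hX : HasDerivAt (f ∘ c) X 0) {x : M} (hx : c 0 = x) :
    X ∈ (mfderiv 𝓘(ℝ, E) 𝓘(ℝ, F) f x).range := by
  subst hx
  -- The embedding makes `c` continuous at `0`; the immersion then makes it smooth there.
  have h1 : ContMDiffAt 𝓘(ℝ, ℝ) 𝓘(ℝ, E) ∞ c 0 := by
    rw [ContMDiffAt.iff_comp_isImmersionAt (hf.isImmersion.isImmersionAt (c 0))]
    exact ⟨hf.isEmbedding.continuousAt_iff.2 hc.continuousAt, hc.contMDiffAt⟩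
  have h2 := mfderiv_comp (0 : ℝ) (hf.contMDiff.contMDiffAt.mdifferentiableAt (by simp))
    (h1.mdifferentiableAt (by simp))
  rw [mfderiv_eq_fderiv, hX.hasFDerivAt.fderiv] at h2
  have h3 := DFunLike.congr_fun h2 (1 : ℝ)
  refine ⟨mfderiv 𝓘(ℝ, ℝ) 𝓘(ℝ, E) c 0 (1 : ℝ), ?_⟩
  exact h3.symm.trans (one_smul ℝ X)

end Immersion

/-! ### The Lie bracket in a matrix-like representation. -/

section Bracket

variable {A : Type*} [NormedRing A] [NormedAlgebra ℝ A] {E : Type*} [NormedAddCommGroup E]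
  [NormedSpace ℝ E] {G : Type*} [Group G] [TopologicalSpace G]
  [ChartedSpace E G]

/-- The derivative at the identity of a smooth representation of a Lie group in an algebra. -/
def groupLieAlgebraMap (f : G →* A) : GroupLieAlgebra 𝓘(ℝ, E) G →L[ℝ] A :=
  mfderiv 𝓘(ℝ, E) 𝓘(ℝ, A) f 1

variable [LieGroup 𝓘(ℝ, E) ∞ G]

/-- Differentiate `f (g h) = f g * f h` in `h` at the identity. -/
theorem mfderiv_mulInvariantVectorField {f : G →* A} (hf : ContMDiff 𝓘(ℝ, E) 𝓘(ℝ, A) ∞ f)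
    (X : GroupLieAlgebra 𝓘(ℝ, E) G) (g : G) :
    (mfderiv 𝓘(ℝ, E) 𝓘(ℝ, A) f g : E →L[ℝ] A) (mulInvariantVectorField X g : E) =
      f g * groupLieAlgebraMap f X := by
  have h1 := mfderiv_comp (1 : G) (hf.contMDiffAt.mdifferentiableAt (by simp))
    ((contMDiff_mul_left (I := 𝓘(ℝ, E)) (n := ∞) (a := g)).contMDiffAt.mdifferentiableAt (by simp))
  have hd : DifferentiableAt ℝ (fun y : A => f g * y) (f 1) := by fun_prop
  have h2 := mfderiv_comp (1 : G) hd.mdifferentiableAt (hf.contMDiffAt.mdifferentiableAt (by simp))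
  have hfun : (f ∘ fun h => g * h) = (fun y : A => f g * y) ∘ f := by
    ext h
    simp
  have hm : (mfderiv 𝓘(ℝ, A) 𝓘(ℝ, A) (fun y : A => f g * y) (f 1) : A →L[ℝ] A) =
      ContinuousLinearMap.mul ℝ A (f g) :=
    mfderiv_eq_fderiv.trans (ContinuousLinearMap.mul ℝ A (f g)).fderiv
  rw [hfun, h2, hm] at h1
  have h3 := DFunLike.congr_fun h1 X
  have h4 (g' : G) (hg : g' = g) : (mfderiv 𝓘(ℝ, E) 𝓘(ℝ, A) f g' : E →L[ℝ] A) =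
      (mfderiv 𝓘(ℝ, E) 𝓘(ℝ, A) f g : E →L[ℝ] A) := by
    subst hg
    rfl
  rw [← h4 (g * 1) (mul_one g)]
  exact h3.symm

/-- In a chart, the derivative of `f` along the field of `Z` is `f * Z`; differentiating again along
the field of `Z'` gives `Z' * Z` at the identity. The bracket of fields is the commutator of these
derivations. -/
theorem groupLieAlgebraMap_bracket [CompleteSpace E] {f : G →* A}
    (hf : ContMDiff 𝓘(ℝ, E) 𝓘(ℝ, A) ∞ f)
    (X Y : GroupLieAlgebra 𝓘(ℝ, E) G) :
    groupLieAlgebraMap f ⁅X, Y⁆ = groupLieAlgebraMap f X * groupLieAlgebraMap f Y -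
      groupLieAlgebraMap f Y * groupLieAlgebraMap f X := by
  have : LieGroup 𝓘(ℝ, E) (minSmoothness ℝ 3) G := LieGroup.of_le (n := ∞) (by
    rw [minSmoothness_of_isRCLikeNormedField]; exact ENat.LEInfty.out)
  have : IsManifold 𝓘(ℝ, E) 2 G := IsManifold.of_le (n := ∞) ENat.LEInfty.out
  have : IsManifold 𝓘(ℝ, E) 1 G := IsManifold.of_le (n := ∞) ENat.LEInfty.out
  set φ := extChartAt 𝓘(ℝ, E) (1 : G)
  let P (Z : GroupLieAlgebra 𝓘(ℝ, E) G) : E → E :=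
    VectorField.mpullbackWithin 𝓘(ℝ, E) 𝓘(ℝ, E) φ.symm (mulInvariantVectorField Z)
      (Set.range 𝓘(ℝ, E))
  have hs : φ.symm ⁻¹' Set.univ ∩ Set.range 𝓘(ℝ, E) = Set.univ := by simp
  have hP (Z) : DifferentiableAt ℝ (P Z) (φ 1) := by
    have h := (mdifferentiableAt_mulInvariantVectorField Z
      (g := (1 : G))).mdifferentiableWithinAt
        (s := Set.univ) |>.differentiableWithinAt_mpullbackWithin_vectorField
    have hd (V : E → E) (s : Set E) (u : E) (hs : s = Set.univ)
        (h : DifferentiableWithinAt ℝ V s u) : DifferentiableAt ℝ V u := by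
      rwa [hs, differentiableWithinAt_univ] at h
    exact hd _ _ _ hs h
  have ht : φ.target ∈ 𝓝 (φ 1) := extChartAt_target_mem_nhds 1
  have hF : ∀ u ∈ φ.target, ContDiffAt ℝ ∞ (f ∘ φ.symm) u := by
    intro u hu
    have h1 := (contMDiffOn_extChartAt_symm (I := 𝓘(ℝ, E)) (n := ∞) (1 : G)).contMDiffAt
      ((isOpen_extChartAt_target (I := 𝓘(ℝ, E)) (1 : G)).mem_nhds hu)
    exact (hf.contMDiffAt.comp u h1).contDiffAt
  have key (Z) : ∀ u ∈ φ.target,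
      fderiv ℝ (f ∘ φ.symm) u (P Z u) = f (φ.symm u) * groupLieAlgebraMap f Z := by
    intro u hu
    have h1 := (contMDiffOn_extChartAt_symm (I := 𝓘(ℝ, E)) (n := ∞) (1 : G)).contMDiffAt
      ((isOpen_extChartAt_target (I := 𝓘(ℝ, E)) (1 : G)).mem_nhds hu)
    have h2 := mfderiv_comp u (hf.contMDiffAt.mdifferentiableAt (by simp))
      (h1.mdifferentiableAt (by simp))
    rw [mfderiv_eq_fderiv] at h2
    rw [← mfderiv_mulInvariantVectorField hf Z (φ.symm u)]
    refine (DFunLike.congr_fun h2 (P Z u)).trans ?_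
    have h3 := isInvertible_mfderivWithin_extChartAt_symm (I := 𝓘(ℝ, E)) (x := (1 : G)) hu
    have h4 := h3.self_apply_inverse (mulInvariantVectorField Z (φ.symm u))
    rw [ModelWithCorners.range_eq_univ, mfderivWithin_univ] at h4
    refine congrArg (mfderiv 𝓘(ℝ, E) 𝓘(ℝ, A) f (φ.symm u) : E →L[ℝ] A) ?_
    refine Eq.trans ?_ h4
    simp only [P, VectorField.mpullbackWithin, ModelWithCorners.range_eq_univ, mfderivWithin_univ]
    rfl
  have hbr : (⁅X, Y⁆ : GroupLieAlgebra 𝓘(ℝ, E) G) = VectorField.lieBracket ℝ (P X) (P Y) (φ 1) := by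
    have hid (T : E →L[ℝ] E) (w : E) (hT : T = ContinuousLinearMap.id ℝ E) : T.inverse w = w := by
      rw [hT, ContinuousLinearMap.inverse_id, ContinuousLinearMap.id_apply]
    rw [GroupLieAlgebra.bracket_def, ← VectorField.mlieBracketWithin_univ,
      VectorField.mlieBracketWithin_apply]
    have hl (V W : E → E) (s : Set E) (u : E) (hs : s = Set.univ) :
        VectorField.lieBracketWithin ℝ V W s u = VectorField.lieBracket ℝ V W u := by
      rw [hs, VectorField.lieBracketWithin_univ]
    exact (hid _ _ mfderiv_extChartAt_self).trans (hl _ _ _ _ hs)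
  have hL (w : E) : groupLieAlgebraMap f w = fderiv ℝ (f ∘ φ.symm) (φ 1) w := by
    have h (k : E → A) (k' : E →L[ℝ] A) (u : E) (hk : HasFDerivAt k k' u) :
        k' w = fderiv ℝ k u w := by
      rw [hk.fderiv]
    exact h _ _ _
      (hf.contMDiffAt.mdifferentiableAt (by simp)).hasFDerivAt_comp_extChartAt_symm
  have hφ1 : φ.symm (φ 1) = 1 := extChartAt_to_inv (1 : G)
  have hD (Z Z') : fderiv ℝ (fun u => fderiv ℝ (f ∘ φ.symm) u (P Z u)) (φ 1) (P Z' (φ 1)) =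
      groupLieAlgebraMap f Z' * groupLieAlgebraMap f Z := by
    have h1 : (fun u => fderiv ℝ (f ∘ φ.symm) u (P Z u)) =ᶠ[𝓝 (φ 1)]
        fun u => (f ∘ φ.symm) u * groupLieAlgebraMap f Z :=
      Filter.eventuallyEq_of_mem ht (key Z)
    have h2 := key Z' (φ 1) (mem_of_mem_nhds ht)
    rw [hφ1, map_one, one_mul] at h2
    rw [h1.fderiv_eq, fderiv_mul_const'
      ((hF _ (mem_of_mem_nhds ht)).differentiableAt (by simp)), ← h2]
    rfl
  rw [hbr, hL, VectorField.fderiv_apply_lieBracket (hF _ (mem_of_mem_nhds ht))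
    (by rw [minSmoothness_of_isRCLikeNormedField]; exact ENat.LEInfty.out) (hP Y) (hP X), hD, hD]

end Bracket

/-! ### The Lie algebra of the Lipschitz group. -/

namespace Cl

variable {n : ℕ}

/-- A velocity at the identity of a curve in the paravector Lipschitz group has degree at most
two. -/
theorem mem_degreeLE_two_of_hasDerivAt {c : ℝ → lipschitzGroup n} (h0 : c 0 = 1) {X : Cl n}
    (hc : HasDerivAt (incl n ∘ c) X 0) : X ∈ degreeLE n 2 := by
  have : CompleteSpace (Cl n) := FiniteDimensional.complete ℝ _
  refine mem_degreeLE_two_of_commutator fun x hx => ?_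
  have hinv : HasDerivAt (fun t => Ring.inverse (incl n (c t))) (-X) 0 := by
    have h := HasFDerivAt.comp_hasDerivAt_of_eq (0 : ℝ)
      (hasFDerivAt_ringInverse (𝕜 := ℝ) (1 : (Cl n)ˣ)) hc (by rw [Function.comp_apply, h0]; rfl)
    simpa [Function.comp_def] using h
  have hcurve (t : ℝ) : incl n (c t) * x *
      CliffordAlgebra.involute (Ring.inverse (incl n (c t))) ∈ paravectors n := by
    rw [incl, Ring.inverse_unit]
    exact (lipschitzGroup_le_twistedStabilizer (c t).2).1 x hx
  let J : Cl n →L[ℝ] Cl n := LinearMap.toContinuousLinearMap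
    (CliffordAlgebra.involute (Q := negDefForm n)).toLinearMap
  -- The product rule for `g x ĝ⁻¹` along the curve gives the velocity `X x - x X̂`, a limit of
  -- paravectors.
  have hd := (hc.mul_const x).mul (J.hasFDerivAt.comp_hasDerivAt (0 : ℝ) hinv)
  have hJ (y : Cl n) : J y = CliffordAlgebra.involute y := rfl
  have h1 : incl n 1 = 1 := rfl
  simp only [Function.comp_apply, h0, h1, Ring.inverse_one, hJ, map_one, map_neg, mul_one, one_mul,
    mul_neg, ← sub_eq_add_neg] at hd
  have hcl : IsClosed (paravectors n : Set (Cl n)) := Submodule.closed_of_finiteDimensional _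
  refine hcl.mem_of_tendsto (hasDerivAt_iff_tendsto_slope.1 hd) (Eventually.of_forall fun t => ?_)
  exact Submodule.smul_mem _ _ (sub_mem (hcurve t) (hcurve 0))

/-- A monomial of degree at most two is the velocity at the identity of a curve in the paravector
Lipschitz group that is smooth as a curve in the Clifford algebra. -/
theorem exists_curve_monomial {I : Finset (Fin n)} (hI : I.card ≤ 2) :
    ∃ c : ℝ → lipschitzGroup n, c 0 = 1 ∧ ContDiffAt ℝ ∞ (incl n ∘ c) 0 ∧
      HasDerivAt (incl n ∘ c) (monomial I) 0 := by
  -- The value `1` for `|t| ≥ 1` is a filler; only small `t` matters.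
  have h (t : ℝ) : ∃ g : lipschitzGroup n, |t| < 1 → incl n g = 1 + t • monomial I := by
    by_cases ht : |t| < 1
    · obtain ⟨g, hg, hgt⟩ := exists_mem_lipschitzGroup_one_add_smul_monomial hI ht
      exact ⟨⟨g, hg⟩, fun _ => hgt⟩
    · exact ⟨1, fun h => absurd h ht⟩
  choose c hc using h
  have hev : incl n ∘ c =ᶠ[𝓝 0] fun t => 1 + t • monomial I := by
    filter_upwards [Metric.ball_mem_nhds (0 : ℝ) one_pos] with t ht
    exact hc t (by simpa using ht)
  refine ⟨c, ?_, ContDiffAt.congr_of_eventuallyEq (by fun_prop) hev,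
    HasDerivAt.congr_of_eventuallyEq ?_ hev⟩
  · have h0 := hc 0 (by simp)
    rw [zero_smul, add_zero] at h0
    exact Subtype.ext (Units.ext h0)
  · simpa using ((hasDerivAt_id (0 : ℝ)).smul_const (monomial I)).const_add 1

theorem range_lieIncl {d : ℕ} [ChartedSpace (EuclideanSpace ℝ (Fin d)) (lipschitzGroup n)]
    (h : IsEmbeddedLieGroup n d) : (lieIncl n d).range = degreeLE n 2 := by
  have := h.lieGroup
  refine le_antisymm ?_ (Submodule.span_le.2 ?_)
  · rintro _ ⟨v, rfl⟩
    obtain ⟨c, hc, hcv⟩ :=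
      (h.isSmoothEmbedding.contMDiff.contMDiffAt.mdifferentiableAt (by simp)).exists_curve v
    exact mem_degreeLE_two_of_hasDerivAt hc hcv
  · rintro _ ⟨I, hI, rfl⟩
    obtain ⟨c, hc, hcs, hcI⟩ := exists_curve_monomial hI
    exact h.isSmoothEmbedding.mem_range_mfderiv hcs hcI hc

end Cl

end

theorem mainTheorem12 (n : ℕ) :
    -- the paravector Lipschitz group is an embedded Lie group
    (∃ (d : ℕ) (_ : ChartedSpace (EuclideanSpace ℝ (Fin d)) (Cl.lipschitzGroup n)),
      Cl.IsEmbeddedLieGroup n d) ∧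
    -- its Lie algebra consists of the elements of degree at most two, with the commutator bracket
    (∀ (d : ℕ) [ChartedSpace (EuclideanSpace ℝ (Fin d)) (Cl.lipschitzGroup n)],
      Cl.IsEmbeddedLieGroup n d →
        Function.Injective (Cl.lieIncl n d) ∧
        (Cl.lieIncl n d).range = Cl.degreeLE n 2 ∧
        ∀ X Y : GroupLieAlgebra (𝓡 d) (Cl.lipschitzGroup n),
          Cl.lieIncl n d ⁅X, Y⁆ =
            Cl.lieIncl n d X * Cl.lieIncl n d Y - Cl.lieIncl n d Y * Cl.lieIncl n d X) ∧
    -- and this space is the direct sum of the scalars, the vectors and the bivectors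
    Cl.degreeLE n 2 = Cl.scalars n ⊔ Cl.vectors n ⊔ Cl.bivectors n ∧
    iSupIndep ![Cl.scalars n, Cl.vectors n, Cl.bivectors n] := by
  refine ⟨Cl.exists_isEmbeddedLieGroup n, fun d _ h => ⟨?_, Cl.range_lieIncl h, ?_⟩,
    Cl.degreeLE_two_eq, Cl.iSupIndep_scalars_vectors_bivectors⟩
  · exact (h.isSmoothEmbedding.isImmersion.isImmersionAt 1).mfderiv_injective
  · have := h.lieGroup
    exact groupLieAlgebraMap_bracket
      (f := (Units.coeHom (Cl n)).comp (Cl.lipschitzGroup n).subtype) h.isSmoothEmbedding.contMDiff
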